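/- Let $r\ge 1$, and order $\mathbb N^r$ componentwise. A \emph{good semigroup} of $\mathbb N^r$ is a submonoid $S$ of $(\mathbb N^r,+)$ such that: (i) $\min(a,b)\in S$ for all $a,b\in S$; (ii) if $a,b\in S$ and $a[i]=b[i]$, there is $c\in S$ with $c[i]>a[i]$, $c[j]\ge\min(a[j],b[j])$ for all $j\ne i$, and $c[j]=\min(a[j],b[j])$ whenever $a[j]\ne b[j]$; (iii) there is $\delta\in S$ with $\delta+\mathbb N^r\subseteq S$. It is \emph{local} if $\mathbf 0$ is its only element with a zero component, and \emph{Arf} if $S(\alpha)-\alpha$ is closed under addition for every $\alpha\in S$, where $S(\alpha)=\{\beta\in S:\beta\ge\alpha\}$. Its \emph{conductor} is the least $\delta$ with $\delta+\mathbb N^r\subseteq S$. With $C=\delta+\mathbb N^r$, its \emph{genus} is $g(S)=d(\mathbb N^r\setminus C)-d(S\setminus C)$, where $d(\mathbb N^r\setminus C)$ and $d(S\setminus C)$ are the lengths of saturated chains from $\mathbf 0$ to $\delta$ in $\mathbb N^r$ and in $S$, respectively (a chain is saturated if it cannot be refined in the set considered). Let $T$ be an infinite rooted tree with branches $1,\dots,r$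 and levels $1,2,\dots$, all branches sharing the root at level $1$. The node of the $i$-th branch at level $j$ carries a vector $\mathbf n_i^j\in\mathbb N^r$. Two branches are \emph{glued} at level $j$ if they have the same node there; they are then glued at all lower levels. Let $S(T)$ consist of $\mathbf 0$ and all the sums $\sum_{\mathbf n\in T'}\mathbf n$, where $T'$ ranges over the finite subtrees of $T$ containing the root. $T$ is a \emph{multiplicity tree of a local Arf good semigroup} if $S(T)$ is a local Arf good semigroup and, for all $i,j,h$, $\mathbf n_i^j[h]=0$ if and only if the node is not in the $h$-th branch. $T$ is \emph{untwisted} if, for all $i<h$, branches $i$ and $h$ are glued at level $l$ if and only if, for every $i\le k<h$, branches $k$ and $k+1$ are glued at some level $\ge l$. A \emph{multiplicity sequence} is a nonincreasing sequence $M=(m_j)_{j\ge1}$ of positive integers that is eventually equal to $1$ and such that for every $j$ there is $l\ge j+1$ with $m_j=\sum_{k=j+1}^{l}m_k$. Put $\mathrm{AS}(M)=\{0,\,m_1,\,m_1+m_2,\,\dots\}$ and $g(\mathrm{AS}(M))=|\mathbb N\setminus \mathrm{AS}(M)|$. \textbf{Theorem.} Let $T$ be an untwisted multiplicity tree of a local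 Arf good semigroup $S(T)\subseteq\mathbb N^r$. For $1\le k\le r$ let $M_k=(\mathbf n_k^j[k])_{j\ge1}$ be the sequence along the $k$-th branch, and for $1\le k\le r-1$ let $p_k$ be the highest level at which branches $k$ and $k+1$ are glued. Then each $M_k$ is a multiplicity sequence, the genus of $S(T)$ is well defined (it exists and does not depend on the choice of the saturated chains), and $$g(S(T))=\sum_{k=1}^{r}g(\mathrm{AS}(M_k))+\sum_{k=1}^{r-1}p_k .$$ -/

import Mathlib

/-- A good semigroup of `ℕ^r`. -/
structure IsGoodSemigroup {r : ℕ} (S : AddSubmonoid (Fin r → ℕ)) : Prop where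
  inf_mem : ∀ a ∈ S, ∀ b ∈ S, a ⊓ b ∈ S
  exists_gt : ∀ a ∈ S, ∀ b ∈ S, ∀ i, a i = b i →
    ∃ c ∈ S, a i < c i ∧ (∀ j, j ≠ i → min (a j) (b j) ≤ c j) ∧
      ∀ j, a j ≠ b j → c j = min (a j) (b j)
  exists_add_mem : ∃ δ ∈ S, ∀ x : Fin r → ℕ, δ + x ∈ S

/-- `S` is local: zero is the only element of `S` with a zero component. -/
def IsLocalSemigroup {r : ℕ} (S : AddSubmonoid (Fin r → ℕ)) : Prop :=
  ∀ a ∈ S, (∃ i, a i = 0) → a = 0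

/-- The Arf property. Here `{x | α + x ∈ S}` is `S(α) - α`, where
`S(α) = {β ∈ S | α ≤ β}`; it has to be closed under addition for every `α ∈ S`. -/
def HasArfProperty {r : ℕ} (S : AddSubmonoid (Fin r → ℕ)) : Prop :=
  ∀ α ∈ S, ∀ x y : Fin r → ℕ, α + x ∈ S → α + y ∈ S → α + (x + y) ∈ S

/-- A local Arf good semigroup of `ℕ^r`. -/
structure IsLocalArfSemigroup {r : ℕ} (S : AddSubmonoid (Fin r → ℕ)) : Prop where
  good : IsGoodSemigroup S
  isLocal : IsLocalSemigroup S
  arf : HasArfProperty S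

/-- `δ` is the conductor of `S`: the least vector with `δ + ℕ^r ⊆ S`. -/
def IsConductor {r : ℕ} (S : AddSubmonoid (Fin r → ℕ)) (δ : Fin r → ℕ) : Prop :=
  IsLeast {c : Fin r → ℕ | ∀ x : Fin r → ℕ, c + x ∈ S} δ

/-- There is a saturated chain `α = α₀ < α₁ < ⋯ < αₙ = β` of length `n` in `S`: between two
consecutive terms there is no further element of `S`. -/
def HasSaturatedChain {r : ℕ} (S : AddSubmonoid (Fin r → ℕ)) (α β : Fin r → ℕ) (n : ℕ) : Prop :=
  ∃ c : RelSeries {x : S × S | x.1 ⋖ x.2},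
    (c.head : Fin r → ℕ) = α ∧ (c.last : Fin r → ℕ) = β ∧ c.length = n

/-- `g` is a genus of `S`: if `δ` is the conductor and `C = δ + ℕ^r`, then
`g = d(ℕ^r ∖ C) - d(S ∖ C)`, the two terms being the lengths of saturated chains from `0` to `δ`
in `ℕ^r` and in `S`. A priori `g` could depend on the chains; that it does not is part of what
`∀ g, IsGenus S g ↔ g = g₀` says. -/
def IsGenus {r : ℕ} (S : AddSubmonoid (Fin r → ℕ)) (g : ℤ) : Prop :=
  ∃ (δ : Fin r → ℕ) (m n : ℕ), IsConductor S δ ∧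
    HasSaturatedChain (⊤ : AddSubmonoid (Fin r → ℕ)) 0 δ m ∧
    HasSaturatedChain S 0 δ n ∧ g = (m : ℤ) - (n : ℤ)

/-- A multiplicity sequence `m₁ ≥ m₂ ≥ ⋯`, with `m_{j+1}` written `M j`. -/
structure IsMultiplicitySequence (M : ℕ → ℕ) : Prop where
  pos : ∀ j, 0 < M j
  antitone : Antitone M
  eventually_one : ∃ k, ∀ j, k ≤ j → M j = 1
  eq_sum : ∀ j, ∃ l, j + 1 ≤ l ∧ M j = ∑ k ∈ Finset.Icc (j + 1) l, M k

/-- `AS(M) = {0, m₁, m₁ + m₂, m₁ + m₂ + m₃, …}`. -/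
def arfNumericalSet (M : ℕ → ℕ) : Set ℕ :=
  {x | ∃ k, x = ∑ j ∈ Finset.range k, M j}

/-- The genus of a numerical semigroup: the number of its gaps. -/
noncomputable def numericalGenus (A : Set ℕ) : ℕ :=
  (Aᶜ).ncard

/-- An infinite rooted tree with `r` branches whose nodes carry vectors of `ℕ^r`.
The levels `1, 2, 3, …` are indexed by `0, 1, 2, …`. The relation `glued j` holds between two
branches that have the same node at the level of index `j`, so that the nodes of that level are
the classes of `glued j`; all branches are glued at the root, and branches that are glued
at some level are glued at the preceding one. -/
structure VectorTree (r : ℕ) where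
  glued : ℕ → Setoid (Fin r)
  glued_zero : glued 0 = ⊤
  glued_succ_le : ∀ j, glued (j + 1) ≤ glued j
  vec : (j : ℕ) → Quotient (glued j) → Fin r → ℕ

namespace VectorTree

/-- The branches `i` and `h` are glued at the level of index `j`. -/
def Glued {r : ℕ} (T : VectorTree r) (j : ℕ) (i h : Fin r) : Prop :=
  T.glued j i h

/-- The nodes of the tree: a level together with a class of branches glued there. -/
abbrev Node {r : ℕ} (T : VectorTree r) : Type :=
  Σ j : ℕ, Quotient (T.glued j)

/-- The node of the `i`-th branch at the level of index `j`. -/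
def node {r : ℕ} (T : VectorTree r) (i : Fin r) (j : ℕ) : T.Node :=
  ⟨j, Quotient.mk (T.glued j) i⟩

/-- The vector that a node carries. -/
def nodeVec {r : ℕ} (T : VectorTree r) (v : T.Node) : Fin r → ℕ :=
  T.vec v.1 v.2

/-- A finite set of nodes is a subtree rooted in the root of `T`. -/
structure IsRootedSubtree {r : ℕ} (T : VectorTree r) (F : Finset T.Node) : Prop where
  root_mem : ∀ i, T.node i 0 ∈ F
  parent_mem : ∀ i j, T.node i (j + 1) ∈ F → T.node i j ∈ F

/-- The set `S(T)`: zero and the sums of the nodes of the finite subtrees rooted in the root. -/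
def sums {r : ℕ} (T : VectorTree r) : Set (Fin r → ℕ) :=
  {0} ∪ {x | ∃ F : Finset T.Node, T.IsRootedSubtree F ∧ x = ∑ v ∈ F, T.nodeVec v}

/-- `T` is the multiplicity tree of the local Arf semigroup `S`: a component of a node is zero
exactly when the node is not in the corresponding branch, and `S = S(T)`. -/
structure IsMultiplicityTree {r : ℕ} (T : VectorTree r) (S : AddSubmonoid (Fin r → ℕ)) :
    Prop where
  isLocalArf : IsLocalArfSemigroup S
  eq_zero_iff : ∀ i j h, T.nodeVec (T.node i j) h = 0 ↔ ¬ T.Glued j i h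
  eq_sums : (S : Set (Fin r → ℕ)) = T.sums

/-- The multiplicity sequence `M_i` along the `i`-th branch. -/
def branchSeq {r : ℕ} (T : VectorTree r) (i : Fin r) (j : ℕ) : ℕ :=
  T.nodeVec (T.node i j) i

/-- `p` is the highest level at which the branches `i` and `h` are glued (the level of index `j`
is level `j + 1`). -/
def IsHighestGluedLevel {r : ℕ} (T : VectorTree r) (i h : Fin r) (p : ℕ) : Prop :=
  IsGreatest {l : ℕ | ∃ j, l = j + 1 ∧ T.Glued j i h} p

/-- The tree is untwisted: two branches are glued at a level if and only if all the pairs of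
consecutive branches between them are glued at that level or a higher one. -/
def IsUntwisted {n : ℕ} (T : VectorTree (n + 1)) : Prop :=
  ∀ (l : ℕ) (i h : Fin (n + 1)), i < h →
    (T.Glued l i h ↔ ∀ k : Fin n, i ≤ k.castSucc → k.succ ≤ h →
      ∃ m, l ≤ m ∧ T.Glued m k.castSucc k.succ)

end VectorTree

/-! A finite rooted subtree is determined by how high it reaches on each branch. Since a node is
nonzero exactly on its own branches, component `i` of its sum is the partial sum of `branchSeq i` up
to that height. Multiplicities are positive, so `heightSum` is an order isomorphism from height
vectors onto `S` (`mem_iff`, `heightSum_le_heightSum`).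

A cover in `S` therefore adds exactly one node (`exists_eq_raise`), and a saturated chain from `0`
to `heightSum h` has as many steps as the subtree has nodes. In an untwisted tree each node spans an
interval of branches, so this number is `∑ h i - ∑ min (h k) (p k)`, the second sum removing the
nodes shared by consecutive branches.

At the conductor `δ = heightSum h` all branches have already separated and all later multiplicities
are `1`. Hence the minima are the `p k`, and `δ i - h i` is the number of gaps of `AS(M_i)`.
Subtracting the node count from `∑ δ i`, the chain length in `ℕ^r`, gives the formula for any choice
of chains. -/

open Finset

namespace VectorTree

/-! ### Finite subtrees and height vectors. -/

variable {r : ℕ} (T : VectorTree r)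

/-- A vector of heights on the branches describes a finite subtree: branches that share a node
at some level both reach that level or both fail to. -/
def IsHeightVector (h : Fin r → ℕ) : Prop :=
  ∀ j i k, T.Glued j i k → j < h i → j < h k

/-- The sum of the nodes of the subtree with the given heights, computed branch by branch. -/
def heightSum (h : Fin r → ℕ) : Fin r → ℕ :=
  fun i => ∑ j ∈ range (h i), T.branchSeq i j

variable {T}

theorem Glued.symm {j : ℕ} {i k : Fin r} (h : T.Glued j i k) : T.Glued j k i :=
  (T.glued j).symm h

theorem Glued.trans {j : ℕ} {i k l : Fin r} (h : T.Glued j i k) (h' : T.Glued j k l) :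
    T.Glued j i l :=
  (T.glued j).trans h h'

theorem Glued.refl (j : ℕ) (i : Fin r) : T.Glued j i i :=
  (T.glued j).refl i

theorem Glued.mono {j l : ℕ} {i k : Fin r} (h : T.Glued j i k) (hl : l ≤ j) : T.Glued l i k :=
  (antitone_nat_of_succ_le T.glued_succ_le hl) h

theorem glued_zero_all (i k : Fin r) : T.Glued 0 i k := by
  unfold Glued
  rw [T.glued_zero]
  trivial

theorem node_eq_node {i k : Fin r} {j l : ℕ} :
    T.node i j = T.node k l ↔ j = l ∧ T.Glued j i k := by
  constructor
  · intro h
    obtain rfl : j = l := congrArg Sigma.fst h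
    refine ⟨rfl, ?_⟩
    have h2 := eq_of_heq (Sigma.mk.inj h).2
    exact Quotient.exact h2
  · rintro ⟨rfl, h⟩
    exact congrArg (Sigma.mk j) (Quotient.sound h)

theorem exists_node_eq (v : T.Node) : ∃ i j, v = T.node i j := by
  obtain ⟨j, q⟩ := v
  obtain ⟨i, rfl⟩ := Quotient.exists_rep q
  exact ⟨i, j, rfl⟩

theorem sum_nodeVec_eq_heightSum
    (h0 : ∀ i j h, T.nodeVec (T.node i j) h = 0 ↔ ¬ T.Glued j i h)
    {F : Finset T.Node} {h : Fin r → ℕ} (hF : ∀ i j, T.node i j ∈ F ↔ j < h i) :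
    ∑ v ∈ F, T.nodeVec v = T.heightSum h := by
  classical
  funext i
  rw [Finset.sum_apply]
  have hsub : (range (h i)).image (T.node i) ⊆ F := by
    intro v hv
    obtain ⟨j, hj, rfl⟩ := mem_image.1 hv
    exact (hF i j).2 (mem_range.1 hj)
  rw [← sum_subset hsub, sum_image]
  · rfl
  · intro a _ b _ hab
    exact (node_eq_node.1 hab).1
  · intro v hv hv'
    obtain ⟨k, j, rfl⟩ := exists_node_eq v
    rw [h0]
    intro hg
    have he : T.node k j = T.node i j := node_eq_node.2 ⟨rfl, hg⟩
    rw [he] at hv hv'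
    exact hv' (mem_image_of_mem _ (mem_range.2 ((hF i j).1 hv)))

theorem IsRootedSubtree.exists_heights {F : Finset T.Node} (hF : T.IsRootedSubtree F) :
    ∃ h : Fin r → ℕ, ∀ i j, T.node i j ∈ F ↔ j < h i := by
  classical
  have key : ∀ i, ∃ m, ∀ j, T.node i j ∈ F ↔ j < m := by
    intro i
    have hdown : ∀ j l, j ≤ l → T.node i l ∈ F → T.node i j ∈ F := by
      intro j l hjl
      induction l, hjl using Nat.le_induction with
      | base => exact id
      | succ l _ ih => exact fun h => ih (hF.parent_mem i l h)
    -- Finiteness of `F` leaves a level without nodes; the first level missing on branch `i` is its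
    -- height.
    have hex : ∃ m, T.node i m ∉ F := by
      obtain ⟨m, hm⟩ := Infinite.exists_notMem_finset (F.image Sigma.fst)
      exact ⟨m, fun h => hm (mem_image_of_mem Sigma.fst h)⟩
    refine ⟨Nat.find hex, fun j => ⟨fun hj => ?_, fun hj => ?_⟩⟩
    · by_contra hlt
      exact Nat.find_spec hex (hdown _ _ (not_lt.1 hlt) hj)
    · exact not_not.1 (Nat.find_min hex hj)
  choose h hh using key
  exact ⟨h, hh⟩

theorem IsHeightVector.exists_subtree {h : Fin r → ℕ} (hh : T.IsHeightVector h)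
    (hpos : ∀ i, 0 < h i) :
    ∃ F : Finset T.Node, T.IsRootedSubtree F ∧ ∀ i j, T.node i j ∈ F ↔ j < h i := by
  classical
  let F : Finset T.Node := univ.biUnion fun i => (range (h i)).image (T.node i)
  have hF : ∀ i j, T.node i j ∈ F ↔ j < h i := by
    intro i j
    simp only [F, mem_biUnion, mem_univ, true_and, mem_image, mem_range]
    constructor
    · rintro ⟨k, l, hl, he⟩
      obtain ⟨rfl, hg⟩ := node_eq_node.1 he
      exact hh _ _ _ hg hl
    · exact fun hj => ⟨i, j, hj, rfl⟩
  refine ⟨F, ⟨fun i => (hF i 0).2 (hpos i), fun i j hij => ?_⟩, hF⟩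
  exact (hF i j).2 (Nat.lt_of_succ_lt ((hF i (j + 1)).1 hij))

theorem isHeightVector_const (m : ℕ) : T.IsHeightVector fun _ => m :=
  fun _ _ _ _ h => h

/-- Raising by one the height of all the branches through the first missing node of the branch
`i`. -/
theorem IsHeightVector.raise {h : Fin r → ℕ} (hh : T.IsHeightVector h) (i : Fin r)
    [DecidablePred fun k => T.Glued (h i) i k] :
    T.IsHeightVector fun k => h k + if T.Glued (h i) i k then 1 else 0 := by
  intro j a b hab hj
  dsimp only at hj ⊢
  by_cases ha : T.Glued (h i) i a <;> by_cases hb : T.Glued (h i) i b <;>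
    simp only [ha, hb, if_true, if_false] at hj ⊢
  · rcases lt_or_ge j (h a) with hlt | hge
    · exact Nat.lt_succ_of_lt (hh _ _ _ hab hlt)
    · obtain rfl : j = h a := by omega
      by_contra hcon
      have h1 : h b < h a := by omega
      have h2 := hh (h b) a b (hab.mono h1.le) h1
      omega
  · rcases lt_or_ge j (h i) with hlt | hge
    · exact hh _ _ _ hab (hh _ _ _ (ha.mono hlt.le) hlt)
    · exact absurd (ha.trans (hab.mono hge)) hb
  · exact Nat.lt_succ_of_lt (hh _ _ _ hab hj)
  · exact hh _ _ _ hab hj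

theorem IsHeightVector.eq_of_glued {h : Fin r → ℕ} (hh : T.IsHeightVector h) {i k : Fin r}
    (hg : T.Glued (h i) i k) : h k = h i := by
  apply le_antisymm
  · by_contra hlt
    exact lt_irrefl _ (hh _ _ _ hg.symm (not_le.1 hlt))
  · by_contra hlt
    exact lt_irrefl _ (hh _ _ _ (hg.mono (not_le.1 hlt).le) (not_le.1 hlt))

/-! ### The semigroup as the ordered set of height vectors. -/

namespace IsMultiplicityTree

variable {S : AddSubmonoid (Fin r → ℕ)}

theorem branchSeq_pos (hT : T.IsMultiplicityTree S) (i : Fin r) (j : ℕ) : 0 < T.branchSeq i j :=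
  Nat.pos_of_ne_zero fun h => (hT.eq_zero_iff i j i).1 h (Glued.refl j i)

theorem strictMono_sum (hT : T.IsMultiplicityTree S)
    (i : Fin r) : StrictMono fun m => ∑ j ∈ range m, T.branchSeq i j :=
  strictMono_nat_of_lt_succ fun m => by
    rw [sum_range_succ]
    exact Nat.lt_add_of_pos_right (hT.branchSeq_pos i m)

theorem mem_iff (hT : T.IsMultiplicityTree S)
    {x : Fin r → ℕ} : x ∈ S ↔ ∃ h, T.IsHeightVector h ∧ x = T.heightSum h := by
  rw [← SetLike.mem_coe, hT.eq_sums]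
  constructor
  · rintro (rfl | ⟨F, hF, rfl⟩)
    · exact ⟨fun _ => 0, isHeightVector_const 0, by funext i; simp [heightSum]⟩
    · obtain ⟨h, hh⟩ := hF.exists_heights
      refine ⟨h, fun j i k hg hj => ?_, sum_nodeVec_eq_heightSum hT.eq_zero_iff hh⟩
      rw [← hh] at hj ⊢
      rwa [← node_eq_node.2 ⟨rfl, hg⟩]
  · rintro ⟨h, hh, rfl⟩
    -- All branches share the root, so one zero height forces all heights to vanish; this is the
    -- element `0`, which no rooted subtree has to supply.
    by_cases hpos : ∀ i, 0 < h i
    · obtain ⟨F, hF, hF'⟩ := hh.exists_subtree hpos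
      exact Or.inr ⟨F, hF, (sum_nodeVec_eq_heightSum hT.eq_zero_iff hF').symm⟩
    · left
      push Not at hpos
      obtain ⟨i, hi⟩ := hpos
      funext k
      have hk : h k = 0 := by
        by_contra hk
        have := hh 0 k i (glued_zero_all k i) (Nat.pos_of_ne_zero hk)
        omega
      simp [heightSum, hk]

theorem heightSum_le_heightSum (hT : T.IsMultiplicityTree S) {h h' : Fin r → ℕ} :
    T.heightSum h ≤ T.heightSum h' ↔ h ≤ h' :=
  forall_congr' fun i => (hT.strictMono_sum i).le_iff_le

theorem heightSum_lt_heightSum (hT : T.IsMultiplicityTree S) {h h' : Fin r → ℕ} :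
    T.heightSum h < T.heightSum h' ↔ h < h' := by
  rw [lt_iff_le_not_ge, lt_iff_le_not_ge, hT.heightSum_le_heightSum, hT.heightSum_le_heightSum]

theorem exists_eq_raise (hT : T.IsMultiplicityTree S) {a b : S} (hab : a ⋖ b) {h h' : Fin r → ℕ}
    (hh : T.IsHeightVector h) (hh' : T.IsHeightVector h')
    (ha : (a : Fin r → ℕ) = T.heightSum h) (hb : (b : Fin r → ℕ) = T.heightSum h')
    [∀ i, DecidablePred fun k => T.Glued (h i) i k] :
    ∃ i, h' = fun k => h k + if T.Glued (h i) i k then 1 else 0 := by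
  have hlt : h < h' := by
    rw [← hT.heightSum_lt_heightSum, ← ha, ← hb]
    exact hab.lt
  obtain ⟨hle, i, hi⟩ := Pi.lt_def.1 hlt
  refine ⟨i, ?_⟩
  -- Since `h'` exceeds `h` on branch `i`, it contains the first missing node there, hence reaches
  -- it on every branch through it. So `h < u ≤ h'`, and the cover leaves only `u = h'`.
  set u : Fin r → ℕ := fun k => h k + if T.Glued (h i) i k then 1 else 0 with hu
  have huH : T.IsHeightVector u := hh.raise i
  have hlu : h < u := by
    refine Pi.lt_def.2 ⟨fun k => Nat.le_add_right _ _, i, ?_⟩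
    simp [hu, Glued.refl]
  have hul : u ≤ h' := by
    intro k
    by_cases hk : T.Glued (h i) i k
    · have h1 := hh' _ _ _ hk hi
      have h2 := hh.eq_of_glued hk
      simp only [hu, hk, if_true]
      omega
    · simpa [hu, hk] using hle k
  by_contra hne
  have hul' : u < h' := lt_of_le_of_ne hul (Ne.symm hne)
  refine hab.2 (c := ⟨T.heightSum u, hT.mem_iff.2 ⟨u, huH, rfl⟩⟩) ?_ ?_
  · rw [← Subtype.coe_lt_coe, ha]
    exact hT.heightSum_lt_heightSum.2 hlu
  · rw [← Subtype.coe_lt_coe, hb]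
    exact hT.heightSum_lt_heightSum.2 hul'

/-- Along each branch, the multiplicities above a subtree whose sum `δ` satisfies `δ + ℕ^r ⊆ S`
are all one. -/
theorem branchSeq_eq_one (hT : T.IsMultiplicityTree S)
    {h : Fin r → ℕ} (hδ : ∀ x, T.heightSum h + x ∈ S) (i : Fin r) {j : ℕ}
    (hj : h i ≤ j) : T.branchSeq i j = 1 := by
  -- Every integer from `δ i` on is a partial sum, so consecutive partial sums there differ by one.
  have hsurj : ∀ y, T.heightSum h i ≤ y → ∃ m, y = ∑ l ∈ range m, T.branchSeq i l := by
    intro y hy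
    obtain ⟨u, -, hu⟩ := hT.mem_iff.1 (hδ (Pi.single i (y - T.heightSum h i)))
    refine ⟨u i, ?_⟩
    have := congrFun hu i
    simp only [Pi.add_apply, Pi.single_eq_same] at this
    rw [Nat.add_sub_cancel' hy] at this
    exact this
  have hmono := hT.strictMono_sum i
  obtain ⟨m, hm⟩ := hsurj (∑ l ∈ range j, T.branchSeq i l + 1)
    ((hmono.le_iff_le.2 hj).trans (Nat.le_succ _))
  have h1 : j < m := hmono.lt_iff_lt.1 (show ∑ l ∈ range j, _ < ∑ l ∈ range m, _ by omega)
  have h2 : ∑ l ∈ range (j + 1), T.branchSeq i l ≤ ∑ l ∈ range m, T.branchSeq i l :=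
    hmono.le_iff_le.2 h1
  rw [sum_range_succ] at h2
  have := hT.branchSeq_pos i j
  omega

/-- The Arf property at the full subtree of height `j`, with `x = y` the vector of multiplicities at
level index `j`, makes the previous partial sum plus `2 m_j` a partial sum again. Removing the terms
up to `m_j` writes the remaining `m_j` as a sum of the terms that follow. -/
theorem isMultiplicitySequence (hT : T.IsMultiplicityTree S)
    (i : Fin r) : IsMultiplicitySequence (T.branchSeq i) := by
  have hsum : ∀ j, ∃ l, j + 1 ≤ l ∧ T.branchSeq i j = ∑ k ∈ Icc (j + 1) l, T.branchSeq i k := by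
    intro j
    set α := T.heightSum fun _ => j with hα
    have hαS : α ∈ S := hT.mem_iff.2 ⟨_, isHeightVector_const j, rfl⟩
    have hx : α + (fun k => T.branchSeq k j) ∈ S := by
      refine hT.mem_iff.2 ⟨_, isHeightVector_const (j + 1), ?_⟩
      funext k
      simp [hα, heightSum, sum_range_succ]
    obtain ⟨u, -, hu⟩ := hT.mem_iff.1 (hT.isLocalArf.arf α hαS _ _ hx hx)
    have hui := congrFun hu i
    simp only [Pi.add_apply, hα, heightSum] at hui
    have hmono := hT.strictMono_sum i
    have hpos := hT.branchSeq_pos i j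
    have hlt : j + 1 < u i := by
      refine hmono.lt_iff_lt.1 (show ∑ l ∈ range (j + 1), _ < ∑ l ∈ range (u i), _ from ?_)
      rw [sum_range_succ]
      omega
    refine ⟨u i - 1, by omega, ?_⟩
    have h3 := sum_range_add_sum_Ico (T.branchSeq i) hlt.le
    rw [sum_range_succ] at h3
    have h4 : Icc (j + 1) (u i - 1) = Ico (j + 1) (u i) := by
      ext x
      simp only [mem_Icc, mem_Ico]
      omega
    rw [h4]
    omega
  refine ⟨hT.branchSeq_pos i, antitone_nat_of_succ_le fun j => ?_, ?_, hsum⟩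
  · obtain ⟨l, hl, he⟩ := hsum j
    rw [he]
    exact single_le_sum (f := T.branchSeq i) (fun _ _ => Nat.zero_le _)
      (mem_Icc.2 ⟨le_rfl, hl⟩)
  · obtain ⟨δ, hδ, hadd⟩ := hT.isLocalArf.good.exists_add_mem
    obtain ⟨h, -, rfl⟩ := hT.mem_iff.1 hδ
    exact ⟨h i, fun j => hT.branchSeq_eq_one hadd i⟩

/-- Different branches are no longer glued above a subtree whose sum `δ` satisfies
`δ + ℕ^r ⊆ S`. -/
theorem lt_of_glued (hT : T.IsMultiplicityTree S)
    {h : Fin r → ℕ} (hh : T.IsHeightVector h) (hδ : ∀ x, T.heightSum h + x ∈ S)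
    {i k : Fin r} (hik : i ≠ k) {j : ℕ} (hg : T.Glued j i k) : j < h i := by
  by_contra hj
  have hk : ¬ j < h k := fun hk => hj (hh _ _ _ hg.symm hk)
  have hle : T.heightSum h i ≤ ∑ l ∈ range (j + 1), T.branchSeq i l :=
    (hT.strictMono_sum i).le_iff_le.2 (by omega)
  -- Increase only component `i`, up to height `j + 1`: the shared node of index `j` would then
  -- force branch `k` above its unchanged height.
  obtain ⟨u, huH, hu⟩ := hT.mem_iff.1
    (hδ (Pi.single i (∑ l ∈ range (j + 1), T.branchSeq i l - T.heightSum h i)))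
  have hui := congrFun hu i
  have huk := congrFun hu k
  simp only [Pi.add_apply, Pi.single_eq_same, Pi.single_eq_of_ne hik.symm, add_zero] at hui huk
  rw [Nat.add_sub_cancel' hle] at hui
  have e1 : j + 1 = u i := (hT.strictMono_sum i).injective hui
  have e2 : h k = u k := (hT.strictMono_sum k).injective huk
  have := huH _ _ _ hg (by omega)
  omega

end IsMultiplicityTree

/-! ### Counting nodes in an untwisted tree. -/

theorem IsHighestGluedLevel.glued_iff {i k : Fin r} {p : ℕ} (hp : T.IsHighestGluedLevel i k p)
    {j : ℕ} : T.Glued j i k ↔ j < p := by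
  constructor
  · exact fun hg => hp.2 ⟨j, rfl, hg⟩
  · intro hj
    obtain ⟨l, rfl, hl⟩ := hp.1
    exact hl.mono (Nat.le_of_lt_succ hj)

/-- In an untwisted tree the branches through a node form an interval, so that they are one more
than the pairs of consecutive branches among them. -/
theorem IsUntwisted.card_glued {n : ℕ} {T : VectorTree (n + 1)} (hU : T.IsUntwisted) (l : ℕ)
    (i : Fin (n + 1)) [DecidablePred fun k => T.Glued l i k]
    [DecidablePred fun k : Fin n => T.Glued l i k.castSucc ∧ T.Glued l k.castSucc k.succ] :
    #{k | T.Glued l i k} =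
      #{k : Fin n | T.Glued l i k.castSucc ∧ T.Glued l k.castSucc k.succ} + 1 := by
  classical
  set C : Finset (Fin (n + 1)) := {k | T.Glued l i k} with hC
  have hmem : ∀ k, k ∈ C ↔ T.Glued l i k := by simp [hC]
  have hne : C.Nonempty := ⟨i, (hmem i).2 (Glued.refl l i)⟩
  have hmin := C.min'_mem hne
  rw [← card_erase_add_one hmin]
  congr 1
  symm
  -- Sending a glued pair to its upper branch is a bijection onto the class without its least
  -- branch; surjectivity is where untwistedness enters.
  rw [← card_map (Fin.succEmb n)]
  congr 1
  ext c
  simp only [mem_map, mem_filter, mem_univ, true_and, mem_erase, Fin.coe_succEmb]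
  constructor
  · rintro ⟨k, ⟨hk, hk'⟩, rfl⟩
    refine ⟨fun he => ?_, (hmem _).2 (hk.trans hk')⟩
    have h1 := C.min'_le _ ((hmem _).2 hk)
    rw [← he] at h1
    exact absurd k.castSucc_lt_succ (not_lt.2 h1)
  · rintro ⟨hc, hcC⟩
    have hlt : C.min' hne < c := lt_of_le_of_ne (C.min'_le _ hcC) (Ne.symm hc)
    obtain ⟨k, rfl⟩ := Fin.exists_succ_eq.2 (Fin.ne_zero_of_lt hlt)
    have hgc := (hmem _).1 hcC
    obtain ⟨m, hm, hg⟩ := (hU l _ _ hlt).1 (((hmem _).1 hmin).symm.trans hgc) k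
      (Fin.le_castSucc_iff.2 hlt) le_rfl
    have hg' := hg.mono hm
    exact ⟨k, ⟨hgc.trans hg'.symm, hg'⟩, rfl⟩

/-- The number of nodes of the subtree with the given heights in an untwisted tree whose
consecutive branches are glued up to the levels `p k`. -/
def nodeCount {n : ℕ} (p : Fin n → ℕ) (h : Fin (n + 1) → ℕ) : ℤ :=
  ∑ i, (h i : ℤ) - ∑ k, ((min (h k.castSucc) (p k) : ℕ) : ℤ)

theorem IsUntwisted.nodeCount_raise {n : ℕ} {T : VectorTree (n + 1)} (hU : T.IsUntwisted)
    {p : Fin n → ℕ} (hp : ∀ k : Fin n, T.IsHighestGluedLevel k.castSucc k.succ (p k))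
    {h : Fin (n + 1) → ℕ} (hh : T.IsHeightVector h) (i : Fin (n + 1))
    [DecidablePred fun k => T.Glued (h i) i k] :
    nodeCount p (fun k => h k + if T.Glued (h i) i k then 1 else 0) = nodeCount p h + 1 := by
  classical
  -- A raised branch has height `h i`, so its minimum grows exactly when `h i < p k`, that is, when
  -- the next branch also passes through the new node. By `card_glued` all increments but one
  -- cancel.
  have hmin : ∀ k : Fin n,
      (min (h k.castSucc + if T.Glued (h i) i k.castSucc then 1 else 0) (p k) : ℕ) =
        min (h k.castSucc) (p k) +
          if T.Glued (h i) i k.castSucc ∧ T.Glued (h i) k.castSucc k.succ then 1 else 0 := by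
    intro k
    by_cases hk : T.Glued (h i) i k.castSucc
    · have he := hh.eq_of_glued hk
      simp only [hk, if_true, true_and, (hp k).glued_iff]
      split_ifs <;> omega
    · simp [hk]
  have hcard := hU.card_glued (h i) i
  simp only [nodeCount, hmin]
  push_cast
  rw [sum_add_distrib, sum_add_distrib, sum_boole, sum_boole, hcard]
  push_cast
  ring

end VectorTree

/-! ### Saturated chains and their lengths. -/

/-- A rank function makes chain length depend on the endpoints only. It is used with the coordinate
sum on `ℕ^r` and with `nodeCount` on `S`. -/
theorem RelSeries.eq_add_length {α : Type*} {s : SetRel α α} (f : α → ℤ)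
    (hf : ∀ a b, (a, b) ∈ s → f b = f a + 1) (c : RelSeries s) :
    f c.last = f c.head + c.length := by
  have key : ∀ m (hm : m < c.length + 1), f (c ⟨m, hm⟩) = f c.head + m := by
    intro m
    induction m with
    | zero => intro hm; simp [RelSeries.head]
    | succ m ih =>
      intro hm
      have h1 := hf _ _ (c.step ⟨m, by omega⟩)
      have h2 := ih (by omega)
      simp only [Fin.castSucc_mk, Fin.succ_mk] at h1
      rw [h1, h2]
      push_cast
      ring
  exact key c.length (Nat.lt_succ_self _)

theorem exists_hasSaturatedChain {r : ℕ} (S : AddSubmonoid (Fin r → ℕ)) {α β : Fin r → ℕ}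
    (hα : α ∈ S) (hβ : β ∈ S) (h : α ≤ β) : ∃ n, HasSaturatedChain S α β n := by
  classical
  let _ : LocallyFiniteOrder S := Subtype.instLocallyFiniteOrder (fun x => x ∈ S)
  have hle : (⟨α, hα⟩ : S) ≤ ⟨β, hβ⟩ := h
  rw [le_iff_reflTransGen_covBy] at hle
  have key : ∀ b : S, Relation.ReflTransGen (· ⋖ ·) (⟨α, hα⟩ : S) b →
      ∃ c : RelSeries {x : S × S | x.1 ⋖ x.2}, c.head = ⟨α, hα⟩ ∧ c.last = b := by
    intro b hb
    induction hb with
    | refl => exact ⟨RelSeries.singleton _ _, rfl, rfl⟩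
    | tail _ hbc ih =>
      obtain ⟨c, h1, h2⟩ := ih
      refine ⟨c.snoc _ (by rw [h2]; exact hbc), ?_, by simp⟩
      simpa using h1
  obtain ⟨c, h1, h2⟩ := key _ hle
  exact ⟨c.length, c, by rw [h1], by rw [h2], rfl⟩

theorem HasSaturatedChain.length_eq_sum {r m : ℕ} {δ : Fin r → ℕ}
    (h : HasSaturatedChain (⊤ : AddSubmonoid (Fin r → ℕ)) 0 δ m) :
    (m : ℤ) = ∑ i, (δ i : ℤ) := by
  classical
  obtain ⟨c, h1, h2, rfl⟩ := h
  have := RelSeries.eq_add_length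
    (fun a : (⊤ : AddSubmonoid (Fin r → ℕ)) => ∑ i, ((a : Fin r → ℕ) i : ℤ)) (fun a b hab => ?_) c
  · simp only [h1, h2] at this
    simpa using this.symm
  · have hab : a ⋖ b := hab
    obtain ⟨hle, i, hi⟩ := Pi.lt_def.1 (Subtype.coe_lt_coe.2 hab.lt)
    -- A cover in `ℕ^r` adds a unit vector: otherwise `a + e_i` would lie strictly between.
    have hb : (b : Fin r → ℕ) = (a : Fin r → ℕ) + Pi.single i 1 := by
      by_contra hne
      refine hab.2 (c := ⟨(a : Fin r → ℕ) + Pi.single i 1, trivial⟩) ?_ ?_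
      · rw [← Subtype.coe_lt_coe]
        exact Pi.lt_def.2 ⟨fun k => Nat.le_add_right _ _, i, by simp⟩
      · rw [← Subtype.coe_lt_coe]
        refine lt_of_le_of_ne (fun k => ?_) (Ne.symm hne)
        by_cases hk : k = i
        · subst hk
          simpa using hi
        · simpa [hk] using hle k
    simp only [hb, Pi.add_apply]
    push_cast
    rw [sum_add_distrib]
    simp [Pi.single_apply]

open VectorTree in
theorem HasSaturatedChain.length_eq_nodeCount {n m : ℕ} {S : AddSubmonoid (Fin (n + 1) → ℕ)}
    {T : VectorTree (n + 1)} (hT : T.IsMultiplicityTree S) (hU : T.IsUntwisted) {p : Fin n → ℕ}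
    (hp : ∀ k : Fin n, T.IsHighestGluedLevel k.castSucc k.succ (p k)) {h : Fin (n + 1) → ℕ}
    (hc : HasSaturatedChain S 0 (T.heightSum h) m) :
    (m : ℤ) = nodeCount p h := by
  classical
  obtain ⟨c, h1, h2, rfl⟩ := hc
  choose H hH hH' using fun a : S => hT.mem_iff.1 a.2
  have hinj : ∀ u v : Fin (n + 1) → ℕ, T.heightSum u = T.heightSum v → u = v := fun u v huv =>
    le_antisymm (hT.heightSum_le_heightSum.1 huv.le) (hT.heightSum_le_heightSum.1 huv.ge)
  have hzero : T.heightSum 0 = 0 := by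
    funext i
    simp [heightSum]
  have := RelSeries.eq_add_length (fun a : S => nodeCount p (H a)) (fun a b hab => ?_) c
  · have e1 : H c.head = 0 := hinj _ _ (by rw [← hH', h1, hzero])
    have e2 : H c.last = h := hinj _ _ (by rw [← hH', h2])
    simp only [e1, e2] at this
    rw [this]
    simp [nodeCount]
  · obtain ⟨i, hi⟩ := hT.exists_eq_raise hab (hH a) (hH b) (hH' a) (hH' b)
    simp only [hi]
    exact hU.nodeCount_raise hp (hH a) i

/-! ### The conductor, numerical gaps and the genus formula. -/

/-- The vectors `c` with `c + ℕ^r ⊆ S` are closed under `⊓`, so a minimal one is the least. -/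
theorem IsGoodSemigroup.exists_isConductor {r : ℕ} {S : AddSubmonoid (Fin r → ℕ)}
    (hS : IsGoodSemigroup S) : ∃ δ, IsConductor S δ := by
  obtain ⟨c, -, hc⟩ := hS.exists_add_mem
  obtain ⟨δ, hδ, hmin⟩ := WellFounded.has_min (wellFounded_lt (α := Fin r → ℕ))
    {c : Fin r → ℕ | ∀ x : Fin r → ℕ, c + x ∈ S} ⟨c, hc⟩
  refine ⟨δ, hδ, fun b hb => ?_⟩
  have hinf : δ ⊓ b ∈ {c : Fin r → ℕ | ∀ x : Fin r → ℕ, c + x ∈ S} := by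
    intro x
    have : δ ⊓ b + x = (δ + x) ⊓ (b + x) := by
      funext i
      simp only [Pi.add_apply, Pi.inf_apply]
      omega
    rw [this]
    exact hS.inf_mem _ (hδ x) _ (hb x)
  by_contra hle
  exact hmin _ hinf (inf_lt_left.2 hle)

/-- From the `m`-th partial sum on there are no gaps; below it lie exactly the `m` earlier partial
sums. -/
theorem numericalGenus_arfNumericalSet {M : ℕ → ℕ} (hpos : ∀ j, 0 < M j) {m : ℕ}
    (hM : ∀ j, m ≤ j → M j = 1) :
    (numericalGenus (arfNumericalSet M) : ℤ) = ∑ j ∈ range m, (M j : ℤ) - m := by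
  classical
  have hmono : StrictMono fun k => ∑ j ∈ range k, M j :=
    strictMono_nat_of_lt_succ fun k => by
      rw [sum_range_succ]
      exact Nat.lt_add_of_pos_right (hpos k)
  have hsum : ∀ d, ∑ j ∈ range (m + d), M j = ∑ j ∈ range m, M j + d := by
    intro d
    rw [sum_range_add, sum_congr rfl fun j _ => hM (m + j) (Nat.le_add_right _ _)]
    simp
  set I := (range m).image fun k => ∑ j ∈ range k, M j with hI
  have hIsub : I ⊆ range (∑ j ∈ range m, M j) := by
    intro y hy
    obtain ⟨k, hk, rfl⟩ := mem_image.1 hy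
    exact mem_range.2 (hmono (mem_range.1 hk))
  have hset : (arfNumericalSet M)ᶜ = ↑(range (∑ j ∈ range m, M j) \ I) := by
    ext y
    simp only [Set.mem_compl_iff, arfNumericalSet, Set.mem_ofPred_eq, coe_sdiff, Set.mem_sdiff,
      mem_coe, mem_range, hI, mem_image]
    constructor
    · intro hy
      refine ⟨?_, fun ⟨k, _, hk⟩ => hy ⟨k, hk.symm⟩⟩
      by_contra hlt
      refine hy ⟨m + (y - ∑ j ∈ range m, M j), ?_⟩
      rw [hsum]
      omega
    · rintro ⟨hlt, hy⟩ ⟨k, rfl⟩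
      exact hy ⟨k, hmono.lt_iff_lt.1 hlt, rfl⟩
  rw [numericalGenus, hset, Set.ncard_coe_finset, cast_card_sdiff hIsub,
    card_image_of_injective _ hmono.injective]
  simp

theorem mainTheorem1 {n : ℕ} (S : AddSubmonoid (Fin (n + 1) → ℕ)) (T : VectorTree (n + 1))
    (hT : T.IsMultiplicityTree S) (hU : T.IsUntwisted) (p : Fin n → ℕ)
    (hp : ∀ k : Fin n, T.IsHighestGluedLevel k.castSucc k.succ (p k)) :
    (∀ k, IsMultiplicitySequence (T.branchSeq k)) ∧
      ∀ g : ℤ, IsGenus S g ↔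
        g = (∑ k, (numericalGenus (arfNumericalSet (T.branchSeq k)) : ℤ)) + ∑ k, (p k : ℤ) := by
  refine ⟨hT.isMultiplicitySequence, ?_⟩
  have key : ∀ δ m l, IsConductor S δ →
      HasSaturatedChain (⊤ : AddSubmonoid (Fin (n + 1) → ℕ)) 0 δ m → HasSaturatedChain S 0 δ l →
      (m : ℤ) - l =
        (∑ k, (numericalGenus (arfNumericalSet (T.branchSeq k)) : ℤ)) + ∑ k, (p k : ℤ) := by
    intro δ m l hδ hm hl
    have hadd : ∀ x, δ + x ∈ S := hδ.1
    obtain ⟨h, hh, rfl⟩ := hT.mem_iff.1 (by simpa using hadd 0)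
    -- The last shared node has index `j = p k - 1`, and `lt_of_glued` puts it below the height of
    -- the branch.
    have hpk : ∀ k : Fin n, min (h k.castSucc) (p k) = p k := by
      intro k
      obtain ⟨j, hj, hg⟩ := (hp k).1
      have := hT.lt_of_glued hh hadd k.castSucc_lt_succ.ne hg
      omega
    rw [hm.length_eq_sum, hl.length_eq_nodeCount hT hU hp, VectorTree.nodeCount]
    simp only [hpk]
    rw [sum_congr rfl fun k _ => numericalGenus_arfNumericalSet (hT.branchSeq_pos k)
      fun j => hT.branchSeq_eq_one hadd k (j := j), sum_sub_distrib]
    simp only [VectorTree.heightSum]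
    push_cast
    ring
  intro g
  constructor
  · rintro ⟨δ, m, l, hδ, hm, hl, rfl⟩
    exact key δ m l hδ hm hl
  · rintro rfl
    obtain ⟨δ, hδ⟩ := hT.isLocalArf.good.exists_isConductor
    have hδS : δ ∈ S := by simpa using hδ.1 0
    obtain ⟨m, hm⟩ := exists_hasSaturatedChain ⊤ (AddSubmonoid.mem_top 0)
      (AddSubmonoid.mem_top δ) (fun _ => Nat.zero_le _)
    obtain ⟨l, hl⟩ := exists_hasSaturatedChain S S.zero_mem hδS (fun _ => Nat.zero_le _)
    exact ⟨δ, m, l, hδ, hm, hl, (key δ m l hδ hm hl).symm⟩
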